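/- For a list $X=(x_1,\dots,x_n)$ of vectors in $\mathbb R^d$, let $\lambda_1\ge\lambda_2\ge\dots$ be the eigenvalues of $\Sigma=\frac1n\sum_i x_ix_i^T$, let $v^*$ be a top unit eigenvector of $\Sigma$, and let $P=I-v^*(v^*)^T$. A stream has spectral gap (at least) $R$ if $\lambda_1>0$ and $\lambda_1\ge R\lambda_2$. A unit vector $u$ is an $\varepsilon$-approximate PCA solution if $\|Pu\|^2\le\varepsilon$. A randomized streaming algorithm reads $x_1,\dots,x_n$ once, in order, and keeps only a finite bit string between two insertions. Its transitions and its final output may be arbitrary (measurable) functions of a random seed, the number of vectors read, the stored bits and (for transitions) the new vector, where the seed and the count are not charged as space. It solves $\varepsilon$-approximate PCA on a class of streams if on each stream of the class it outputs an $\varepsilon$-approximate PCA solution with probability at least $2/3$. **Theorem 5.** For every constant $R>1$ there are constants $\varepsilon>0$, $c>0$ and $d_0$, depending only on $R$, such that for every $d\ge d_0$ the following holds. Let $\mathcal X_{d,R}$ be the class of streams of exactly $d$ vectors in $\{-1,0,1\}^d$ with spectral gap at least $R$. Every randomized streaming algorithm that solves $\varepsilon$-approximate PCA on $\mathcal X_{d,R}$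 uses $\Omega(d^2)$ bits of space: there are a stream in $\mathcal X_{d,R}$ and a time $t\le d$ such that the expected number of bits stored after the first $t$ vectors of the stream is at least $c\,d^2$. In particular, every algorithm that solves $\varepsilon$-approximate PCA on all streams in $\mathbb R^d$ with spectral gap at least $R$ uses $\Omega(d^2)$ bits of space. -/

import Mathlib

open scoped ENNReal

noncomputable section

namespace StreamingPCA

/-- A data point in `ℝ^d`, with the Euclidean norm. -/
abbrev Vec (d : ℕ) : Type := EuclideanSpace ℝ (Fin d)

/-- The covariance matrix `Σ = (1/n) ∑ᵢ xᵢ xᵢᵀ = (1/n) Xᵀ X` of the data points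
`x₁, …, xₙ` (the rows of `X`). -/
def covariance {d : ℕ} (xs : List (Vec d)) : Matrix (Fin d) (Fin d) ℝ :=
  (xs.length : ℝ)⁻¹ • (xs.map fun x => Matrix.vecMulVec x.ofLp x.ofLp).sum

theorem covariance_isHermitian {d : ℕ} (xs : List (Vec d)) :
    (covariance xs).IsHermitian := by
  have h : ∀ l : List (Vec d),
      ((l.map fun x => Matrix.vecMulVec x.ofLp x.ofLp).sum).IsHermitian := by
    intro l
    induction l with
    | nil => simp
    | cons x l ih =>
      rw [List.map_cons, List.sum_cons]
      refine Matrix.IsHermitian.add ?_ ih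
      ext i j
      simp [Matrix.conjTranspose_apply, Matrix.vecMulVec_apply, mul_comm]
  unfold covariance Matrix.IsHermitian
  rw [Matrix.conjTranspose_smul, (h xs).eq]
  simp

/-- The eigenvalues of the covariance matrix, with multiplicity, in decreasing order:
`eigenvalue xs 0 = λ₁ ≥ eigenvalue xs 1 = λ₂ ≥ …` (and `0` from the index `d` on). -/
def eigenvalue {d : ℕ} (xs : List (Vec d)) (i : ℕ) : ℝ :=
  if h : i < Fintype.card (Fin d) then (covariance_isHermitian xs).eigenvalues₀ ⟨i, h⟩ else 0

/-- The stream has spectral gap (at least) `R`: `λ₁ / λ₂ ≥ R`, where `λ₁ > 0` and `λ₂ = 0`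
counts as an infinite ratio. -/
def HasSpectralGap {d : ℕ} (R : ℝ) (xs : List (Vec d)) : Prop :=
  0 < eigenvalue xs 0 ∧ R * eigenvalue xs 1 ≤ eigenvalue xs 0

/-- `v` is a top unit eigenvector `v*` of the covariance matrix. -/
def IsPrincipalComponent {d : ℕ} (xs : List (Vec d)) (v : Vec d) : Prop :=
  ‖v‖ = 1 ∧ (covariance xs).mulVec v.ofLp = eigenvalue xs 0 • v.ofLp

/-- The unit vector `u` is an `ε`-approximate PCA solution: `‖P u‖² ≤ ε` with
`P = I - v* v*ᵀ`. (When `λ₁ > λ₂` the vector `v*` is unique up to its sign, and the sign does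
not matter.) -/
def IsApproxPCA {d : ℕ} (ε : ℝ) (xs : List (Vec d)) (u : Vec d) : Prop :=
  ‖u‖ = 1 ∧ ∃ v : Vec d, IsPrincipalComponent xs v ∧ ‖u - inner ℝ v u • v‖ ^ 2 ≤ ε

/-- A randomized one-pass (insertion-only) streaming algorithm in dimension `d`, whose internal
randomness is a point `ω` of a probability space `Ω`. Between two insertions the algorithm keeps
nothing but a finite bit string. The transition, which also may depend on the number `t` of
vectors read before, and the final output are arbitrary functions of the random seed, the stored
bits and the new vector: neither the seed, nor the clock, nor the working memory inside a step is
charged. Algorithms that draw fresh random bits at each step are covered (`ω` is then the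
sequence of all draws), and so are deterministic ones. -/
structure StreamingAlgorithm (d : ℕ) (Ω : Type*) [MeasurableSpace Ω] where
  /-- the stored bits before the first vector -/
  init : Ω → List Bool
  /-- the stored bits after the vector `x` has been read at time `t` in memory state `s` -/
  step : (ω : Ω) → (t : ℕ) → (s : List Bool) → (x : Vec d) → List Bool
  /-- the vector returned in memory state `s` at the end of the stream -/
  output : (ω : Ω) → (s : List Bool) → Vec d
  measurable_init : ∀ s, MeasurableSet {ω | init ω = s}
  measurable_step : ∀ t s x s', MeasurableSet {ω | step ω t s x = s'}
  measurable_output : ∀ s, Measurable fun ω => output ω s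

namespace StreamingAlgorithm

variable {d : ℕ} {Ω : Type*} [MeasurableSpace Ω]

/-- The memory reached from state `s` at time `t` after reading the given vectors in order. -/
def runFrom (alg : StreamingAlgorithm d Ω) (ω : Ω) : ℕ → List Bool → List (Vec d) → List Bool
  | _, s, [] => s
  | t, s, x :: xs => runFrom alg ω (t + 1) (alg.step ω t s x) xs

/-- The memory of the algorithm after it has read the vectors `xs`. -/
def memory (alg : StreamingAlgorithm d Ω) (ω : Ω) (xs : List (Vec d)) : List Bool :=
  alg.runFrom ω 0 (alg.init ω) xs

/-- The vector returned on the stream `xs`. -/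
def result (alg : StreamingAlgorithm d Ω) (ω : Ω) (xs : List (Vec d)) : Vec d :=
  alg.output ω (alg.memory ω xs)

/-- The expected number of bits stored after the vectors `xs` have been read. -/
def expectedBits (alg : StreamingAlgorithm d Ω) (P : MeasureTheory.Measure Ω)
    (xs : List (Vec d)) : ℝ≥0∞ :=
  ∫⁻ ω, ((alg.memory ω xs).length : ℝ≥0∞) ∂P

/-- The algorithm solves `ε`-approximate PCA on a class of streams: on every stream of the class,
it returns an `ε`-approximate solution with probability at least `2/3`. -/
def SolvesPCA (alg : StreamingAlgorithm d Ω) (P : MeasureTheory.Measure Ω) (ε : ℝ)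
    (streams : Set (List (Vec d))) : Prop :=
  ∀ xs ∈ streams, 2 / 3 ≤ P {ω | IsApproxPCA ε xs (alg.result ω xs)}

end StreamingAlgorithm

/-- The streams of exactly `d` vectors in `ℝ^d`, all of whose entries are `-1`, `0` or `1`, that
have spectral gap at least `R`. The bounds on the length and on the entries make the lower bound
below stronger, and keep it from being a mere effect of the magnitude of unbounded inputs: to
compare `m` copies of `a • e₁` with `n` copies of `b • e₂` takes unboundedly many bits in any
dimension `d ≥ 2` when `a`, `b` or `m`, `n` are unbounded. -/
def gapStreams (d : ℕ) (R : ℝ) : Set (List (Vec d)) :=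
  {xs | xs.length = d ∧ (∀ x ∈ xs, ∀ j, x j = -1 ∨ x j = 0 ∨ x j = 1) ∧ HasSpectralGap R xs}

end StreamingPCA

end

noncomputable section

namespace StreamingPCA

/-! The memory after a prefix of the stream must nearly encode an `N × N` sign matrix `Z`, where `N`
is a power of two of order `d`. The prefix consists of rows `x_j = (H_j, z_j)`, with `H_j` a row of
a Hadamard matrix and `z_j` a row of `Z`. Then `k = O_R(1)` copies of the anchor `y = (H_i, 0)`,
padded by zeros, pose query `i`. If `Z` has operator norm `O(√N)`, the rows contribute at most `320
N` in any direction, while the anchors contribute `k N` in the direction of `y`. So the gap is at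
least `R`, and the top eigenvector `v` is nearly parallel to `y`. Since `y` is orthogonal to every
`x_j` with `j ≠ i`, only `x_i` drags `v` systematically off `y`, towards `z_i`. This gives a
correlation of order `√N` with `z_i` (`le_abs_inner_of_eigenvector`), which approximate solutions
inherit (`le_abs_inner_of_approx`).

For a well-chosen seed, the memory after the prefix therefore determines `N` vectors of norm at most
one, a quarter of which correlate with the matching rows of `Z`. By a Chernoff bound
(`card_sign_matrices_correlated_le`) one memory state serves only an `exp(-Ω(N²))` fraction of all
sign matrices, up to a factor `2^N`, whereas half of them satisfy the norm bound
(`card_boundedSigns`). So `exp(Ω(N²))` states are needed. Markov's inequality and averaging over the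
seed (`exists_outcome_many`) pass from expected bits to a bound for one seed (`exists_compression`).
-/

/-- The sign encoded by a bit. -/
def sgn (b : Bool) : ℝ := if b then 1 else -1

theorem sgn_mul_self (b : Bool) : sgn b * sgn b = 1 := by
  cases b <;> simp [sgn]

/-! ### Exponential moments of random signs -/

section SignMoments

variable {ι : Type*} [Fintype ι] [DecidableEq ι]

theorem sum_exp_signs (w : ι → ℝ) :
    ∑ σ : ι → Bool, Real.exp (∑ i, w i * sgn (σ i)) = ∏ i, (2 * Real.cosh (w i)) := by
  have h : ∀ i, 2 * Real.cosh (w i) = ∑ b : Bool, Real.exp (w i * sgn b) := by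
    intro i
    rw [Real.cosh_eq]
    simp [sgn]
    ring
  simp_rw [Real.exp_sum, h]
  rw [Finset.prod_univ_sum, Fintype.piFinset_univ]

/-- The exponential moment factors over the coordinates, and `cosh x ≤ exp (x² / 2)` in each. Using
`cosh` handles both tails at once. -/
theorem sum_cosh_signs_le (w : ι → ℝ) :
    ∑ σ : ι → Bool, Real.cosh (∑ i, w i * sgn (σ i)) ≤
      2 ^ Fintype.card ι * Real.exp ((∑ i, w i ^ 2) / 2) := by
  have h1 := sum_exp_signs w
  have h2 := sum_exp_signs (fun i => -w i)
  simp only [neg_mul, Finset.sum_neg_distrib, Real.cosh_neg] at h2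
  have h3 : ∑ σ : ι → Bool, Real.cosh (∑ i, w i * sgn (σ i)) = ∏ i, (2 * Real.cosh (w i)) := by
    simp_rw [Real.cosh_eq (∑ i, _)]
    rw [← Finset.sum_div, Finset.sum_add_distrib, h1, h2]
    ring
  rw [h3, Finset.prod_mul_distrib, Finset.prod_const, Finset.card_univ, Finset.sum_div,
    Real.exp_sum]
  gcongr with i
  exact Real.cosh_le_exp_half_sq _

theorem half_exp_abs_le_cosh (x : ℝ) : Real.exp |x| / 2 ≤ Real.cosh x := by
  rw [← Real.cosh_abs, Real.cosh_eq]
  have := Real.exp_pos (-|x|)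
  linarith

/-- Hoeffding's inequality for a random sign vector, as a count. -/
theorem card_signs_large_le (w : ι → ℝ) (hw : ∑ i, w i ^ 2 ≤ 1) {t : ℝ} (ht : 0 ≤ t) :
    (((Finset.univ.filter fun σ : ι → Bool => t ≤ |∑ i, w i * sgn (σ i)|).card : ℕ) : ℝ) ≤
      2 * 2 ^ Fintype.card ι * Real.exp (-(t ^ 2 / 2)) := by
  have h1 := sum_cosh_signs_le (fun i => t * w i)
  have h2 : (((Finset.univ.filter fun σ : ι → Bool =>
      t ≤ |∑ i, w i * sgn (σ i)|).card : ℕ) : ℝ) * (Real.exp (t ^ 2) / 2) ≤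
      ∑ σ : ι → Bool, Real.cosh (∑ i, t * w i * sgn (σ i)) := by
    rw [← nsmul_eq_mul]
    refine (Finset.card_nsmul_le_sum _ _ _ ?_).trans
      (Finset.sum_le_sum_of_subset_of_nonneg (Finset.filter_subset _ _)
        fun _ _ _ => (Real.cosh_pos _).le)
    intro σ hσ
    have hσ' : t ≤ |∑ i, w i * sgn (σ i)| := by simpa using hσ
    refine le_trans ?_ (half_exp_abs_le_cosh _)
    have : ∑ i, t * w i * sgn (σ i) = t * ∑ i, w i * sgn (σ i) := by
      rw [Finset.mul_sum]; simp only [mul_assoc]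
    rw [this, abs_mul, abs_of_nonneg ht]
    gcongr
    nlinarith
  have h3 : Real.exp ((∑ i, (t * w i) ^ 2) / 2) ≤ Real.exp (t ^ 2 / 2) := by
    simp only [mul_pow, ← Finset.mul_sum]
    gcongr
    nlinarith [sq_nonneg t]
  have h4 : Real.exp (t ^ 2) = Real.exp (t ^ 2 / 2) * Real.exp (t ^ 2 / 2) := by
    rw [← Real.exp_add]; ring_nf
  have h5 := Real.exp_pos (t ^ 2 / 2)
  set c := (((Finset.univ.filter fun σ : ι → Bool =>
      t ≤ |∑ i, w i * sgn (σ i)|).card : ℕ) : ℝ)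
  have h6 : c * (Real.exp (t ^ 2) / 2) ≤ 2 ^ Fintype.card ι * Real.exp (t ^ 2 / 2) :=
    h2.trans (h1.trans (by gcongr))
  rw [h4] at h6
  rw [Real.exp_neg, ← div_eq_mul_inv, le_div_iff₀ h5]
  refine le_of_mul_le_mul_right ?_ h5
  linarith

/-- If the rows of a sign matrix are tested against fixed vectors `w i` of norm at most one, then
few sign matrices have a correlation of order `√n` with a quarter of these vectors. -/
theorem card_sign_matrices_correlated_le (w : ι → ι → ℝ) (hw : ∀ i, ∑ j, w i j ^ 2 ≤ 1)
    {δ : ℝ} (hδ : 0 ≤ δ) :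
    (((Finset.univ.filter fun Z : ι → ι → Bool =>
      Fintype.card ι ≤ 4 * (Finset.univ.filter fun i =>
        δ * √(Fintype.card ι) ≤ |∑ j, w i j * sgn (Z i j)|).card).card : ℕ) : ℝ) ≤
      2 ^ (Fintype.card ι ^ 2 + Fintype.card ι) *
        Real.exp (-(δ ^ 2 * (Fintype.card ι : ℝ) ^ 2 / 32)) := by
  set n := Fintype.card ι with hn
  -- The optimal Chernoff parameter: it maximizes `θ · δ√n · n/4 - θ² n/2`, with maximum `δ² n² /
  -- 32`.
  set θ := δ * √n / 4 with hθ
  have hs : √(n : ℝ) ^ 2 = n := Real.sq_sqrt (Nat.cast_nonneg n)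
  have hs0 := Real.sqrt_nonneg (n : ℝ)
  set a := δ ^ 2 * (n : ℝ) / 4 with ha
  have ha0 : 0 ≤ a := by positivity
  have hsum : ∑ Z : ι → ι → Bool, ∏ i, Real.cosh (∑ j, θ * w i j * sgn (Z i j)) ≤
      2 ^ (n ^ 2) * Real.exp (a * n / 8) := by
    have := Finset.prod_univ_sum (fun _ : ι => (Finset.univ : Finset (ι → Bool)))
      (fun i z => Real.cosh (∑ j, θ * w i j * sgn (z j)))
    rw [Fintype.piFinset_univ] at this
    rw [← this]
    have hrow : ∀ i, ∑ z : ι → Bool, Real.cosh (∑ j, θ * w i j * sgn (z j)) ≤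
        2 ^ n * Real.exp (a / 8) := by
      intro i
      refine (sum_cosh_signs_le (fun j => θ * w i j)).trans ?_
      simp only [mul_pow, ← Finset.mul_sum]
      have : θ ^ 2 = a / 4 := by
        rw [hθ, ha, div_pow, mul_pow, hs]; ring
      refine mul_le_mul_of_nonneg_left (Real.exp_le_exp.2 ?_) (by positivity)
      rw [this]
      nlinarith [hw i]
    calc _ ≤ ∏ _i : ι, (2 ^ n * Real.exp (a / 8)) := by
          refine Finset.prod_le_prod (fun i _ => Finset.sum_nonneg fun _ _ => (Real.cosh_pos _).le)
            fun i _ => hrow i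
      _ = _ := by
          rw [Finset.prod_const, Finset.card_univ, ← hn, mul_pow, ← pow_mul, ← Real.exp_nat_mul,
            sq]
          congr 2
          ring
  have hlow : (((Finset.univ.filter fun Z : ι → ι → Bool =>
      n ≤ 4 * (Finset.univ.filter fun i =>
        δ * √n ≤ |∑ j, w i j * sgn (Z i j)|).card).card : ℕ) : ℝ) *
        (Real.exp (a * (n / 4)) / 2 ^ n) ≤
      ∑ Z : ι → ι → Bool, ∏ i, Real.cosh (∑ j, θ * w i j * sgn (Z i j)) := by
    rw [← nsmul_eq_mul]
    refine (Finset.card_nsmul_le_sum _ _ _ ?_).trans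
      (Finset.sum_le_sum_of_subset_of_nonneg (Finset.filter_subset _ _)
        fun _ _ _ => Finset.prod_nonneg fun _ _ => (Real.cosh_pos _).le)
    intro Z hZ
    rw [Finset.mem_filter] at hZ
    set T := Finset.univ.filter fun i => δ * √n ≤ |∑ j, w i j * sgn (Z i j)| with hT
    have hTn : (n : ℝ) / 4 ≤ T.card := by
      have : (n : ℝ) ≤ 4 * T.card := by exact_mod_cast hZ.2
      linarith
    calc Real.exp (a * (n / 4)) / 2 ^ n ≤ Real.exp (a * T.card) / 2 ^ n := by gcongr
      -- Rows outside `T` need only `cosh ≥ 1/2`. The uniform factor `1/2` per row is the source of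
      -- the extra `2 ^ n` in the bound.
      _ = ∏ i, ((if i ∈ T then Real.exp a else 1) / 2) := by
          rw [Finset.prod_div_distrib, Finset.prod_ite_mem, Finset.univ_inter, Finset.prod_const,
            Finset.prod_const, Finset.card_univ, ← hn, ← Real.exp_nat_mul, mul_comm]
      _ ≤ _ := by
          refine Finset.prod_le_prod (fun i _ => by split_ifs <;> positivity) fun i _ => ?_
          split_ifs with hi
          · refine le_trans ?_ (half_exp_abs_le_cosh _)
            have hi' : δ * √n ≤ |∑ j, w i j * sgn (Z i j)| := by simpa [hT] using hi
            have : ∑ j, θ * w i j * sgn (Z i j) = θ * ∑ j, w i j * sgn (Z i j) := by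
              rw [Finset.mul_sum]; simp only [mul_assoc]
            have hθ0 : 0 ≤ θ := by positivity
            rw [this, abs_mul, abs_of_nonneg hθ0]
            have h2 : a = θ * (δ * √n) := by
              rw [hθ, ha]
              linear_combination (-(δ ^ 2 / 4)) * hs
            rw [h2]
            gcongr
          · have := Real.one_le_cosh (∑ j, θ * w i j * sgn (Z i j))
            linarith
  have key := hlow.trans hsum
  have h2n : (0 : ℝ) < 2 ^ n := by positivity
  have he := Real.exp_pos (a * (n / 4))
  rw [← le_div_iff₀ (by positivity)] at key
  refine key.trans (le_of_eq ?_)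
  rw [div_div_eq_mul_div, div_eq_mul_inv, ← Real.exp_neg, pow_add]
  have : Real.exp (-(δ ^ 2 * (n : ℝ) ^ 2 / 32)) =
      Real.exp (a * n / 8) * Real.exp (-(a * (n / 4))) := by
    rw [← Real.exp_add, ha]
    ring_nf
  rw [this]
  ring

end SignMoments

/-! ### Half-nets of the unit ball -/

section Nets

open Module

/-- The unit ball of a finite-dimensional normed space has a `1/2`-net of size `5 ^ dim`. -/
theorem exists_half_net (E : Type*) [NormedAddCommGroup E] [NormedSpace ℝ E]
    [FiniteDimensional ℝ E] :
    ∃ S : Finset E, S.card ≤ 5 ^ finrank ℝ E ∧ (∀ y ∈ S, ‖y‖ ≤ 1) ∧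
      ∀ x : E, ‖x‖ ≤ 1 → ∃ y ∈ S, ‖x - y‖ ≤ 1 / 2 := by
  classical
  by_contra! H
  -- A 1-separated set in the ball of radius 2 has at most `5 ^ dim` points. Halved, it is a
  -- candidate net; a point that it misses, doubled, enlarges the set. So without a net there are
  -- separated sets of every size.
  have hsep : ∀ n : ℕ, ∃ s : Finset E, (∀ c ∈ s, ‖c‖ ≤ 2) ∧
      (∀ c ∈ s, ∀ d ∈ s, c ≠ d → 1 ≤ ‖c - d‖) ∧ s.card = n := by
    intro n
    induction n with
    | zero => exact ⟨∅, by simp⟩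
    | succ n ih =>
      obtain ⟨s, hs, hd, hc⟩ := ih
      have hcard := Besicovitch.card_le_of_separated s hs hd
      obtain ⟨x, hx, hfar⟩ := H (s.image fun c => (1 / 2 : ℝ) • c)
        (Finset.card_image_le.trans hcard) (by
          intro y hy
          obtain ⟨c, hc, rfl⟩ := Finset.mem_image.1 hy
          rw [norm_smul]
          have := hs c hc
          norm_num
          linarith)
      have hfar' : ∀ c ∈ s, 1 < ‖(2 : ℝ) • x - c‖ := by
        intro c hc
        have h1 := hfar _ (Finset.mem_image_of_mem _ hc)
        have h2 : (2 : ℝ) • x - c = (2 : ℝ) • (x - (1 / 2 : ℝ) • c) := by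
          rw [smul_sub, smul_smul]; norm_num
        rw [h2, norm_smul]
        norm_num
        norm_num at h1
        linarith
      refine ⟨insert ((2 : ℝ) • x) s, ?_, ?_, ?_⟩
      · intro c hc
        rcases Finset.mem_insert.1 hc with rfl | hc
        · rw [norm_smul]; norm_num; linarith
        · exact hs c hc
      · intro c hc d hd' hne
        rcases Finset.mem_insert.1 hc with rfl | hc <;>
          rcases Finset.mem_insert.1 hd' with rfl | hd'
        · exact absurd rfl hne
        · exact (hfar' d hd').le
        · rw [norm_sub_rev]; exact (hfar' c hc).le
        · exact hd c hc d hd' hne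
      · rw [Finset.card_insert_of_notMem, hc]
        intro hmem
        have := hfar' _ hmem
        simp at this
        linarith
  obtain ⟨s, hs, hd, hc⟩ := hsep (5 ^ finrank ℝ E + 1)
  have := Besicovitch.card_le_of_separated s hs hd
  omega

/-- Rounding a unit vector to the net costs at most `‖f‖ / 2`, which is absorbed on the left. -/
theorem opNorm_le_of_half_net {E F : Type*} [NormedAddCommGroup E] [NormedSpace ℝ E]
    [NormedAddCommGroup F] [NormedSpace ℝ F] (f : E →L[ℝ] F) {S : Finset E}
    (hS : ∀ x : E, ‖x‖ ≤ 1 → ∃ y ∈ S, ‖x - y‖ ≤ 1 / 2) {t : ℝ} (ht : 0 ≤ t)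
    (h : ∀ y ∈ S, ‖f y‖ ≤ t) : ‖f‖ ≤ 2 * t := by
  have : ‖f‖ ≤ t + ‖f‖ / 2 := by
    refine ContinuousLinearMap.opNorm_le_of_unit_norm (by positivity) fun x hx => ?_
    obtain ⟨y, hy, hxy⟩ := hS x hx.le
    calc ‖f x‖ = ‖f y + f (x - y)‖ := by rw [map_sub]; congr 1; abel
      _ ≤ ‖f y‖ + ‖f (x - y)‖ := norm_add_le _ _
      _ ≤ t + ‖f‖ * (1 / 2) := by
          gcongr
          · exact h y hy
          · exact (f.le_opNorm _).trans (by gcongr)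
      _ = _ := by ring
  linarith

end Nets

/-! ### Operator norm of a random sign matrix -/

section OperatorNorm

variable {ι : Type*} [Fintype ι]

/-- The sign matrix `Z` has operator norm at most `√(160 n)`. -/
def BoundedSigns (Z : ι → ι → Bool) : Prop :=
  ∀ b : ι → ℝ, ∑ i, (∑ j, sgn (Z i j) * b j) ^ 2 ≤ 160 * Fintype.card ι * ∑ j, b j ^ 2

variable [DecidableEq ι]

theorem boundedSigns_of_half_net {S : Finset (EuclideanSpace ℝ ι)}
    (hS : ∀ x : EuclideanSpace ℝ ι, ‖x‖ ≤ 1 → ∃ y ∈ S, ‖x - y‖ ≤ 1 / 2) (Z : ι → ι → Bool)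
    (hZ : ∀ u ∈ S, ∀ v ∈ S, |∑ p : ι × ι, u p.1 * v p.2 * sgn (Z p.1 p.2)| ≤
      √(10 * Fintype.card ι)) :
    BoundedSigns Z := by
  set t := √(10 * (Fintype.card ι : ℝ)) with ht
  have ht0 : 0 ≤ t := Real.sqrt_nonneg _
  set f : EuclideanSpace ℝ ι →L[ℝ] EuclideanSpace ℝ ι :=
    Matrix.toEuclideanCLM (𝕜 := ℝ) (Matrix.of fun i j => sgn (Z i j)) with hf
  have hfi : ∀ x i, f x i = ∑ j, sgn (Z i j) * x j := by
    intro x i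
    simp [hf, Matrix.mulVec, dotProduct]
  -- The net is used twice, for the argument `v` and for the functional `⟨f v, ·⟩`. Hence the factor
  -- 4, and `(4t)² = 160 n`.
  have hnorm : ‖f‖ ≤ 2 * (2 * t) := by
    refine opNorm_le_of_half_net f hS (by positivity) fun v hv => ?_
    rw [← innerSL_apply_norm (𝕜 := ℝ)]
    refine opNorm_le_of_half_net _ hS ht0 fun u hu => ?_
    rw [innerSL_apply_apply, Real.norm_eq_abs]
    refine le_of_eq_of_le ?_ (hZ u hu v hv)
    congr 1
    rw [PiLp.inner_apply, Fintype.sum_prod_type]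
    refine Finset.sum_congr rfl fun i _ => ?_
    rw [hfi, real_inner_eq_re_inner]
    simp only [RCLike.inner_apply, conj_trivial, RCLike.re_to_real, Finset.mul_sum]
    exact Finset.sum_congr rfl fun j _ => by ring
  intro b
  have h1 := f.le_of_opNorm_le hnorm (WithLp.toLp 2 b)
  have h2 : ‖f (WithLp.toLp 2 b)‖ ^ 2 ≤ (2 * (2 * t) * ‖WithLp.toLp 2 b‖) ^ 2 := by gcongr
  rw [EuclideanSpace.real_norm_sq_eq, mul_pow, EuclideanSpace.real_norm_sq_eq] at h2
  simp only [hfi] at h2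
  have h3 : (2 * (2 * t)) ^ 2 = 160 * Fintype.card ι := by
    have : t ^ 2 = 10 * Fintype.card ι := Real.sq_sqrt (by positivity)
    nlinarith
  rwa [h3] at h2

open scoped Classical in
/-- At least half of all sign matrices have an operator norm of order `√n`. -/
theorem card_boundedSigns [Nonempty ι] :
    (2 : ℝ) ^ (Fintype.card ι ^ 2) / 2 ≤
      ((Finset.univ.filter fun Z : ι → ι → Bool => BoundedSigns Z).card : ℝ) := by
  set n := Fintype.card ι with hn
  have hn1 : 1 ≤ n := Fintype.card_pos
  obtain ⟨S, hScard, hSball, hS⟩ := exists_half_net (EuclideanSpace ℝ ι)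
  rw [finrank_euclideanSpace] at hScard
  set t := √(10 * (n : ℝ)) with ht
  have htsq : t ^ 2 = 10 * n := Real.sq_sqrt (by positivity)
  have hpair : ∀ u ∈ S, ∀ v ∈ S, ((Finset.univ.filter fun Z : ι → ι → Bool =>
      t ≤ |∑ p : ι × ι, u p.1 * v p.2 * sgn (Z p.1 p.2)|).card : ℝ) ≤
      2 * 2 ^ (n ^ 2) * Real.exp (-(5 * n)) := by
    intro u hu v hv
    have h1 := card_signs_large_le (fun p : ι × ι => u p.1 * v p.2) (by
      simp only [mul_pow]
      rw [Fintype.sum_prod_type]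
      simp only [← Finset.mul_sum, ← Finset.sum_mul]
      rw [← EuclideanSpace.real_norm_sq_eq, ← EuclideanSpace.real_norm_sq_eq]
      have hu1 := hSball u hu
      have hv1 := hSball v hv
      exact mul_le_one₀ (pow_le_one₀ (norm_nonneg _) hu1) (by positivity)
        (pow_le_one₀ (norm_nonneg _) hv1)) (Real.sqrt_nonneg (10 * (n : ℝ)))
    rw [← ht, htsq, Fintype.card_prod, ← hn, ← sq] at h1
    have h2 : (10 * (n : ℝ)) / 2 = 5 * n := by ring
    rw [h2] at h1
    refine le_of_eq_of_le ?_ h1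
    congr 1
    refine Finset.card_equiv (Equiv.curry ι ι Bool).symm fun Z => ?_
    simp [Function.uncurry]
  have hbad : (Finset.univ.filter fun Z : ι → ι → Bool => ¬ BoundedSigns Z) ⊆
      (S ×ˢ S).biUnion fun q => Finset.univ.filter fun Z : ι → ι → Bool =>
        t ≤ |∑ p : ι × ι, q.1 p.1 * q.2 p.2 * sgn (Z p.1 p.2)| := by
    intro Z hZ
    by_contra hcon
    refine (Finset.mem_filter.1 hZ).2 (boundedSigns_of_half_net hS Z fun u hu v hv => ?_)
    by_contra hlt
    refine hcon (Finset.mem_biUnion.2 ⟨(u, v), Finset.mem_product.2 ⟨hu, hv⟩, ?_⟩)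
    exact Finset.mem_filter.2 ⟨Finset.mem_univ _, (not_le.1 hlt).le⟩
  have hcount : ((Finset.univ.filter fun Z : ι → ι → Bool => ¬ BoundedSigns Z).card : ℝ) ≤
      2 ^ (n ^ 2) / 2 := by
    calc ((Finset.univ.filter fun Z : ι → ι → Bool => ¬ BoundedSigns Z).card : ℝ)
        ≤ ∑ q ∈ S ×ˢ S, ((Finset.univ.filter fun Z : ι → ι → Bool =>
          t ≤ |∑ p : ι × ι, q.1 p.1 * q.2 p.2 * sgn (Z p.1 p.2)|).card : ℝ) := by
          exact_mod_cast (Finset.card_le_card hbad).trans Finset.card_biUnion_le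
      _ ≤ ∑ _q ∈ S ×ˢ S, 2 * 2 ^ (n ^ 2) * Real.exp (-(5 * n)) := by
          refine Finset.sum_le_sum fun q hq => ?_
          exact hpair q.1 (Finset.mem_product.1 hq).1 q.2 (Finset.mem_product.1 hq).2
      _ = (S.card : ℝ) * S.card * (2 * 2 ^ (n ^ 2) * Real.exp (-(5 * n))) := by
          rw [Finset.sum_const, Finset.card_product, nsmul_eq_mul]
          push_cast
          ring
      _ ≤ 5 ^ n * 5 ^ n * (2 * 2 ^ (n ^ 2) * Real.exp (-(5 * n))) := by
          have : (S.card : ℝ) ≤ 5 ^ n := by exact_mod_cast hScard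
          gcongr
      _ = 2 * 2 ^ (n ^ 2) * (25 * Real.exp (-5)) ^ n := by
          rw [mul_pow, ← Real.exp_nat_mul, ← mul_pow]
          norm_num
          ring_nf
      -- The 10 in `t` makes each pair cost `exp (-5n)`, which beats the `25 ^ n` pairs of net
      -- points in the union bound.
      _ ≤ 2 * 2 ^ (n ^ 2) * (1 / 4) := by
          have he : Real.exp (-5) ≤ 1 / 100 := by
            rw [Real.exp_neg, inv_le_comm₀ (Real.exp_pos _) (by norm_num)]
            have h1 : Real.exp 5 = Real.exp 1 ^ 5 := by
              rw [← Real.exp_nat_mul]; norm_num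
            have h2 : (2.7 : ℝ) ≤ Real.exp 1 := by linarith [Real.exp_one_gt_d9]
            have h3 : (2.7 : ℝ) ^ 5 ≤ Real.exp 1 ^ 5 := by gcongr
            rw [h1]
            norm_num at h3 ⊢
            linarith
          have h0 : 0 ≤ 25 * Real.exp (-5) := by positivity
          have h4 : 25 * Real.exp (-5) ≤ 1 / 4 := by linarith
          gcongr
          calc (25 * Real.exp (-5)) ^ n ≤ (25 * Real.exp (-5)) ^ 1 :=
                pow_le_pow_of_le_one h0 (by linarith) hn1
            _ ≤ 1 / 4 := by simpa using h4
      _ = _ := by ring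
  have htot := Finset.card_filter_add_card_filter_not (s := (Finset.univ : Finset (ι → ι → Bool)))
    (fun Z => BoundedSigns Z)
  have hcardfun : (Finset.univ : Finset (ι → ι → Bool)).card = 2 ^ (n ^ 2) := by
    rw [Finset.card_univ, Fintype.card_fun, Fintype.card_fun, Fintype.card_bool, ← hn, ← pow_mul,
      sq]
  rw [hcardfun] at htot
  have htot' : ((Finset.univ.filter fun Z : ι → ι → Bool => BoundedSigns Z).card : ℝ) +
      ((Finset.univ.filter fun Z : ι → ι → Bool => ¬ BoundedSigns Z).card : ℝ) = 2 ^ (n ^ 2) := by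
    exact_mod_cast htot
  linarith

end OperatorNorm

/-! ### Variational bounds for the first two eigenvalues -/

section Rayleigh

variable {d : ℕ}

/-- Clearing the factor `1/n` turns spectral statements into sums over the stream, in which zero
vectors contribute nothing. For the empty stream both sides vanish. -/
theorem length_mul_inner_covariance (xs : List (Vec d)) (v w : Vec d) :
    (xs.length : ℝ) * inner ℝ w (WithLp.toLp 2 ((covariance xs).mulVec v.ofLp)) =
      (xs.map fun x => inner ℝ x v * inner ℝ x w).sum := by
  have h : ∀ l : List (Vec d),
      inner ℝ w (WithLp.toLp 2
        (((l.map fun x => Matrix.vecMulVec x.ofLp x.ofLp).sum).mulVec v.ofLp)) =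
      (l.map fun x => inner ℝ x v * inner ℝ x w).sum := by
    intro l
    induction l with
    | nil => simp
    | cons x l ih =>
      rw [List.map_cons, List.sum_cons, List.map_cons, List.sum_cons, Matrix.add_mulVec,
        WithLp.toLp_add, inner_add_right, ih, Matrix.vecMulVec_mulVec]
      congr 1
      have h1 : x.ofLp ⬝ᵥ v.ofLp = inner ℝ x v := by
        rw [EuclideanSpace.inner_eq_star_dotProduct]; simp [dotProduct_comm]
      rw [h1, op_smul_eq_smul, WithLp.toLp_smul, inner_smul_right, WithLp.toLp_ofLp,
        real_inner_comm w x]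
  rcases eq_or_ne xs.length 0 with h0 | h0
  · rw [List.length_eq_zero_iff] at h0
    simp [h0]
  · rw [covariance, Matrix.smul_mulVec, WithLp.toLp_smul, inner_smul_right, h]
    have : (xs.length : ℝ) ≠ 0 := by exact_mod_cast h0
    field_simp

theorem IsPrincipalComponent.sum_inner {xs : List (Vec d)} {v : Vec d}
    (hv : IsPrincipalComponent xs v) (w : Vec d) :
    (xs.map fun x => inner ℝ x v * inner ℝ x w).sum =
      xs.length * eigenvalue xs 0 * inner ℝ v w := by
  rw [← length_mul_inner_covariance, hv.2, WithLp.toLp_smul, inner_smul_right, WithLp.toLp_ofLp,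
    real_inner_comm v w]
  ring

/-- The eigenvalues of the covariance matrix come with an orthonormal basis of eigenvectors. -/
theorem exists_eigenbasis (xs : List (Vec d)) :
    ∃ b : OrthonormalBasis (Fin d) ℝ (Vec d), ∀ i w,
      (xs.map fun x => inner ℝ x (b i) * inner ℝ x w).sum =
        xs.length * eigenvalue xs i * inner ℝ (b i) w := by
  have hS := Matrix.isSymmetric_toEuclideanLin_iff.mpr (covariance_isHermitian xs)
  have hc : Fintype.card (Fin d) = d := Fintype.card_fin d
  refine ⟨(hS.eigenvectorBasis finrank_euclideanSpace).reindex (finCongr hc), fun i w => ?_⟩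
  have h1 := hS.apply_eigenvectorBasis finrank_euclideanSpace ((finCongr hc).symm i)
  have h2 : eigenvalue xs i = hS.eigenvalues finrank_euclideanSpace ((finCongr hc).symm i) := by
    have hi : (i : ℕ) < Fintype.card (Fin d) := hc.symm ▸ i.2
    rw [eigenvalue, dif_pos hi]
    rfl
  rw [← length_mul_inner_covariance, OrthonormalBasis.reindex_apply, h2]
  rw [Matrix.toLpLin_apply] at h1
  rw [h1, RCLike.ofReal_real_eq_id, id, inner_smul_right, real_inner_comm w]
  ring

theorem eigenvalue_antitone (xs : List (Vec d)) {i j : ℕ} (hij : i ≤ j) (hj : j < d) :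
    eigenvalue xs j ≤ eigenvalue xs i := by
  have hj' : j < Fintype.card (Fin d) := by simpa using hj
  rw [eigenvalue, eigenvalue, dif_pos hj', dif_pos (hij.trans_lt hj')]
  exact (covariance_isHermitian xs).eigenvalues₀_antitone hij

theorem sum_inner_sq_le_eigenvalue_zero (xs : List (Vec d)) (w : Vec d) :
    (xs.map fun x => inner ℝ x w * inner ℝ x w).sum ≤
      xs.length * eigenvalue xs 0 * ‖w‖ ^ 2 := by
  obtain ⟨b, hb⟩ := exists_eigenbasis xs
  have h1 : (xs.map fun x => inner ℝ x w * inner ℝ x w).sum =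
      ∑ i : Fin d, xs.length * eigenvalue xs i * inner ℝ (b i) w ^ 2 := by
    have h2 : ∀ l : List (Vec d), (l.map fun x => inner ℝ x w * inner ℝ x w).sum =
        ∑ i, inner ℝ (b i) w * (l.map fun x => inner ℝ x (b i) * inner ℝ x w).sum := by
      intro l
      induction l with
      | nil => simp
      | cons x l ih =>
        simp only [List.map_cons, List.sum_cons, mul_add, Finset.sum_add_distrib]
        rw [ih, ← b.sum_inner_mul_inner x w, Finset.sum_mul]
        congr 1
        exact Finset.sum_congr rfl fun i _ => by ring
    rw [h2]
    exact Finset.sum_congr rfl fun i _ => by rw [hb]; ring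
  rw [h1, ← b.sum_sq_inner_right w, Finset.mul_sum]
  refine Finset.sum_le_sum fun i _ => ?_
  have := eigenvalue_antitone xs (Nat.zero_le i) i.2
  gcongr

/-- Courant–Fischer: the plane of the first two eigenvectors contains a nonzero vector orthogonal to
`y`, and there the Rayleigh quotient is at least `λ₂`. -/
theorem eigenvalue_one_le (hd : 2 ≤ d) (xs : List (Vec d)) (y : Vec d) {K : ℝ}
    (hK : ∀ w, inner ℝ y w = 0 →
      (xs.map fun x => inner ℝ x w * inner ℝ x w).sum ≤ K * ‖w‖ ^ 2) :
    xs.length * eigenvalue xs 1 ≤ K := by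
  obtain ⟨b, hb⟩ := exists_eigenbasis xs
  set b₀ := b ⟨0, by omega⟩ with hb₀
  set b₁ := b ⟨1, by omega⟩ with hb₁
  have h00 : inner ℝ b₀ b₀ = (1 : ℝ) := by simp [hb₀]
  have h11 : inner ℝ b₁ b₁ = (1 : ℝ) := by simp [hb₁]
  have h01 : inner ℝ b₀ b₁ = (0 : ℝ) := b.orthonormal.2 (by simp)
  have h10 : inner ℝ b₁ b₀ = (0 : ℝ) := by rw [real_inner_comm, h01]
  have hle := eigenvalue_antitone xs (Nat.zero_le 1) (by omega)
  have key : ∀ α β : ℝ, inner ℝ y (α • b₀ + β • b₁) = (0 : ℝ) →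
      xs.length * eigenvalue xs 1 * (α ^ 2 + β ^ 2) ≤ K * (α ^ 2 + β ^ 2) := by
    intro α β hy
    have hsq : ‖α • b₀ + β • b₁‖ ^ 2 = α ^ 2 + β ^ 2 := by
      rw [← real_inner_self_eq_norm_sq]
      simp only [inner_add_left, inner_add_right, real_inner_smul_left, real_inner_smul_right,
        h00, h11, h01, h10]
      ring
    have h1 := hK _ hy
    rw [hsq] at h1
    refine le_trans ?_ h1
    have hlin : ∀ l : List (Vec d), ∀ w : Vec d,
        (l.map fun x => inner ℝ x (α • b₀ + β • b₁) * inner ℝ x w).sum =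
        α * (l.map fun x => inner ℝ x b₀ * inner ℝ x w).sum +
          β * (l.map fun x => inner ℝ x b₁ * inner ℝ x w).sum := by
      intro l w
      induction l with
      | nil => simp
      | cons x l ih =>
        rw [List.map_cons, List.sum_cons, ih]
        simp only [List.map_cons, List.sum_cons, inner_add_right, real_inner_smul_right]
        ring
    rw [hlin, hb, hb]
    simp only [← hb₀, ← hb₁, inner_add_right, real_inner_smul_right, h00, h11, h01, h10]
    have : xs.length * eigenvalue xs 1 * α ^ 2 ≤ xs.length * eigenvalue xs 0 * α ^ 2 := by
      gcongr
    linarith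
  -- The combination `⟨y, b₁⟩ b₀ - ⟨y, b₀⟩ b₁` is always orthogonal to `y`, but is surely nonzero
  -- only when `⟨y, b₁⟩ ≠ 0`; otherwise `b₁` itself serves.
  by_cases h : inner ℝ y b₁ = (0 : ℝ)
  · simpa using key 0 1 (by simp [h])
  · have h2 := key (inner ℝ y b₁) (-inner ℝ y b₀) (by
      simp only [inner_add_right, real_inner_smul_right]; ring)
    refine le_of_mul_le_mul_right h2 ?_
    have := sq_pos_of_ne_zero h
    positivity

end Rayleigh

/-! ### Correlation of the top eigenvector with the hidden signs -/

section Signal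

variable {E : Type*} [NormedAddCommGroup E] [InnerProductSpace ℝ E]
  {ι : Type*} [Fintype ι] [DecidableEq ι]

/-- If a heavy vector `y` is correlated with `x i` only, then a top eigenvector of
`∑ⱼ xⱼ xⱼᵀ + k y yᵀ` is correlated with the part `z` of `x i` that is orthogonal to `y`. -/
theorem le_abs_inner_of_eigenvector {x : ι → E} {i : ι} {y z v : E} {N K k μ : ℝ}
    (hN : 0 < N) (hK : 1 ≤ K) (hk : 16 * K ^ 3 ≤ k)
    (hx : ∀ w, ∑ j, inner ℝ (x j) w ^ 2 ≤ K * N * ‖w‖ ^ 2)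
    (hxy : ∀ j, inner ℝ (x j) y = if j = i then N else 0)
    (hy : ‖y‖ ^ 2 = N) (hz : ‖z‖ ^ 2 = N) (hyz : inner ℝ y z = 0) (hxz : inner ℝ (x i) z = N)
    (hv : ‖v‖ = 1)
    (heig : ∀ w, ∑ j, inner ℝ (x j) v * inner ℝ (x j) w + k * (inner ℝ y v * inner ℝ y w) =
      μ * inner ℝ v w)
    (hμ : k * N ≤ μ) :
    √N ≤ 2 * (K + k) * |inner ℝ v z| := by
  have hK3 : K ≤ K ^ 3 := le_self_pow₀ hK (by norm_num)
  have hk16 : 16 ≤ k := by linarith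
  set c : ℝ := inner ℝ y v with hc
  -- The part of `v` orthogonal to `y`, to be shown small.
  set r : E := v - (c / N) • y with hr
  have hvv : inner ℝ v v = (1 : ℝ) := by rw [real_inner_self_eq_norm_sq, hv]; norm_num
  have hyy : inner ℝ y y = N := by rw [real_inner_self_eq_norm_sq, hy]
  have hrr : ‖r‖ ^ 2 = 1 - c ^ 2 / N := by
    rw [← real_inner_self_eq_norm_sq, hr]
    simp only [inner_sub_left, inner_sub_right, real_inner_smul_left, real_inner_smul_right,
      hvv, hyy, real_inner_comm y v, ← hc]
    field_simp
    ring
  have henergy : μ = ∑ j, inner ℝ (x j) v ^ 2 + k * c ^ 2 := by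
    have := heig v
    rw [hvv, mul_one] at this
    rw [← this]
    simp only [sq, ← hc]
  have hxv := hx v
  rw [hv, one_pow, mul_one] at hxv
  have hr0 : 0 ≤ ‖r‖ ^ 2 := by positivity
  have hcN : c ^ 2 ≤ N := by
    rw [hrr, sub_nonneg, div_le_one hN] at hr0
    exact hr0
  have hμle : μ ≤ (K + k) * N := by
    have : k * c ^ 2 ≤ k * N := by gcongr
    linarith
  -- Energy balance: `k N ≤ μ ≤ K N + k c²`, where `k N - k c² = k ‖r‖² N`.
  have hkr : k * ‖r‖ ^ 2 ≤ K := by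
    have h1 : k * N ≤ K * N + k * c ^ 2 := by linarith
    have h2 : k * ‖r‖ ^ 2 * N = k * N - k * c ^ 2 := by
      rw [hrr]; field_simp
    refine le_of_mul_le_mul_right ?_ hN
    linarith
  have hr16 : K ^ 2 * ‖r‖ ^ 2 ≤ 1 / 16 := by
    have h1 : K ^ 2 * (k * ‖r‖ ^ 2) ≤ K ^ 2 * K := by gcongr
    have h2 : k * (K ^ 2 * ‖r‖ ^ 2) ≤ k * (1 / 16) := by nlinarith
    exact le_of_mul_le_mul_left h2 (by linarith)
  have hc2 : 15 / 16 * N ≤ c ^ 2 := by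
    have h1 : ‖r‖ ^ 2 ≤ 1 / 16 := by nlinarith [one_le_pow₀ hK (n := 2)]
    rw [hrr] at h1
    have h2 : 15 / 16 ≤ c ^ 2 / N := by linarith
    rwa [le_div_iff₀ hN] at h2
  have hs2 : √N ^ 2 = N := Real.sq_sqrt hN.le
  have hs0 : 0 < √N := Real.sqrt_pos.2 hN
  have hcs : 3 / 4 * √N ≤ |c| := by
    refine abs_le_of_sq_le_sq' ?_ (abs_nonneg c) |>.2
    rw [sq_abs, mul_pow, hs2]
    linarith
  set noise : ℝ := ∑ j, inner ℝ (x j) r * inner ℝ (x j) z with hnoise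
  -- The eigenvector equation tested against `z`: the term of `y` vanishes, and the component of `v`
  -- along `y` is seen by `x i` alone, which gives the signal `c N`.
  have hdecomp : μ * inner ℝ v z = c * N + noise := by
    rw [← heig z, hyz, mul_zero, mul_zero, add_zero, hnoise]
    have h1 : ∀ j, inner ℝ (x j) v = inner ℝ (x j) r + if j = i then c else 0 := by
      intro j
      rw [hr, inner_sub_right, real_inner_smul_right, hxy]
      split_ifs
      · field_simp
        ring
      · ring
    simp only [h1, add_mul, Finset.sum_add_distrib, ite_mul, zero_mul]
    rw [Finset.sum_ite_eq' Finset.univ i]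
    simp [hxz]
    ring
  -- Cauchy–Schwarz gives `noise² ≤ K² ‖r‖² N³`; the cube in `16 K³ ≤ k` is what makes `K² ‖r‖²` at
  -- most `1/16`. The signal is at least `3/4 · N√N`.
  have hnoise_le : |noise| ≤ 1 / 4 * (N * √N) := by
    refine abs_le_of_sq_le_sq ?_ (by positivity)
    have h1 : noise ^ 2 ≤ (∑ j, inner ℝ (x j) r ^ 2) * ∑ j, inner ℝ (x j) z ^ 2 :=
      Finset.sum_mul_sq_le_sq_mul_sq _ _ _
    have h2 := hx r
    have h3 := hx z
    rw [hz] at h3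
    calc noise ^ 2 ≤ (K * N * ‖r‖ ^ 2) * (K * N * N) := by
          refine h1.trans ?_
          gcongr
      _ = (K ^ 2 * ‖r‖ ^ 2) * N ^ 3 := by ring
      _ ≤ 1 / 16 * N ^ 3 := by gcongr
      _ = (1 / 4 * (N * √N)) ^ 2 := by
          rw [mul_pow, mul_pow, hs2]; ring
  have hmain : 1 / 2 * (N * √N) ≤ μ * |inner ℝ v z| := by
    have hμ0 : 0 ≤ μ := le_trans (by positivity) hμ
    have h1 : |c * N| = |c| * N := by rw [abs_mul, abs_of_pos hN]
    have h2 : 3 / 4 * √N * N ≤ |c| * N := by gcongr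
    have h3 : |c * N| - |noise| ≤ |c * N + noise| := by
      have := abs_sub_abs_le_abs_sub (c * N) (-noise)
      rwa [abs_neg, sub_neg_eq_add] at this
    rw [← hdecomp, abs_mul μ, abs_of_nonneg hμ0] at h3
    linarith
  have h4 : μ * |inner ℝ v z| ≤ (K + k) * N * |inner ℝ v z| := by gcongr
  refine le_of_mul_le_mul_left ?_ hN
  linarith

/-- The component of `u` along `v` has size at least `1/2`, so it carries `√N / (4L)`; the
remainder, of norm at most `1 / (8L)`, can cancel only half of that. -/
theorem le_abs_inner_of_approx {u v z : E} {N L : ℝ} (hL : 1 ≤ L) (hz : ‖z‖ ^ 2 = N)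
    (hv : ‖v‖ = 1) (hu : ‖u‖ = 1) (hvz : √N ≤ 2 * L * |inner ℝ v z|)
    (huv : ‖u - inner ℝ v u • v‖ ^ 2 ≤ (1 / (8 * L)) ^ 2) :
    1 / (8 * L) * √N ≤ |inner ℝ u z| := by
  set c : ℝ := inner ℝ v u with hc
  set r := u - c • v with hr
  have hL0 : 0 < L := by linarith
  have hδ : 1 / (8 * L) ≤ 1 / 8 := by
    apply one_div_le_one_div_of_le <;> linarith
  have hδ0 : 0 ≤ 1 / (8 * L) := by positivity
  have hvv : inner ℝ v v = (1 : ℝ) := by rw [real_inner_self_eq_norm_sq, hv, one_pow]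
  have huu : inner ℝ u u = (1 : ℝ) := by rw [real_inner_self_eq_norm_sq, hu, one_pow]
  have hrr : ‖r‖ ^ 2 = 1 - c ^ 2 := by
    rw [← real_inner_self_eq_norm_sq, hr]
    simp only [inner_sub_left, inner_sub_right, real_inner_smul_left, real_inner_smul_right,
      huu, hvv, real_inner_comm v u, ← hc]
    ring
  have hr1 : ‖r‖ ≤ 1 / (8 * L) := by
    refine le_of_sq_le_sq ?_ hδ0
    exact huv
  have hc1 : 1 / 2 ≤ |c| := by
    refine le_of_sq_le_sq ?_ (abs_nonneg c)
    rw [sq_abs]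
    nlinarith
  have hzN : ‖z‖ = √N := by rw [← hz, Real.sqrt_sq (norm_nonneg z)]
  have hrz : |inner ℝ r z| ≤ 1 / (8 * L) * √N := by
    refine (abs_real_inner_le_norm r z).trans ?_
    rw [hzN]
    gcongr
  have huz : inner ℝ u z = c * inner ℝ v z + inner ℝ r z := by
    rw [hr, inner_sub_left, real_inner_smul_left]; ring
  have h1 : 1 / 2 * |inner ℝ v z| ≤ |c * inner ℝ v z| := by
    rw [abs_mul]; gcongr
  have h2 : |c * inner ℝ v z| - |inner ℝ r z| ≤ |c * inner ℝ v z + inner ℝ r z| := by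
    have := abs_sub_abs_le_abs_sub (c * inner ℝ v z) (-inner ℝ r z)
    rwa [abs_neg, sub_neg_eq_add] at this
  rw [← huz] at h2
  have h3 : 2 * (1 / (8 * L) * √N) ≤ 1 / 2 * |inner ℝ v z| := by
    have : 2 * (1 / (8 * L) * √N) = √N / (4 * L) := by field_simp; ring
    rw [this, div_le_iff₀ (by positivity)]
    linarith
  linarith

end Signal

/-! ### Hadamard matrices of order a power of two -/

section Hadamard

/-- Sylvester's doubling. Hadamard rows provide anchors that are orthogonal and still have entries
`±1`. -/
theorem exists_isHadamard_two_pow (p : ℕ) :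
    ∃ H : Matrix (Fin (2 ^ p)) (Fin (2 ^ p)) ℝ, H.IsHadamard := by
  induction p with
  | zero =>
    have h1 : (1 : Matrix (Fin 1) (Fin 1) ℝ).IsHadamard := by
      refine ⟨fun i j => ?_, by simp, by simp⟩
      rw [Subsingleton.elim i j, Matrix.one_apply_eq]
      exact one_mem _
    have e : Fin 1 ≃ Fin (2 ^ 0) := finCongr (pow_zero 2).symm
    exact ⟨_, h1.reindex e e⟩
  | succ p ih =>
    obtain ⟨H, hH⟩ := ih
    have h2 : (!![1, 1; 1, -1] : Matrix (Fin 2) (Fin 2) ℝ).IsHadamard := by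
      refine ⟨fun i j => ?_, ?_, ?_⟩
      · fin_cases i <;> fin_cases j <;> simp [Unitary.mem_iff]
      · ext i j
        fin_cases i <;> fin_cases j <;> norm_num [Matrix.mul_apply, Fin.sum_univ_two]
      · ext i j
        fin_cases i <;> fin_cases j <;> norm_num [Matrix.mul_apply, Fin.sum_univ_two]
    have e : Fin (2 ^ p) × Fin 2 ≃ Fin (2 ^ (p + 1)) :=
      finProdFinEquiv.trans (finCongr (pow_succ 2 p).symm)
    exact ⟨_, (hH.kronecker h2).reindex e e⟩

variable {N : ℕ} {H : Matrix (Fin N) (Fin N) ℝ}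

theorem hadamard_apply (hH : H.IsHadamard) (i j : Fin N) : H i j = -1 ∨ H i j = 1 := by
  have := (Unitary.mem_iff.1 (hH.apply_mem i j)).1
  rw [star_trivial] at this
  exact (mul_self_eq_one_iff.1 this).symm

theorem hadamard_sum_mul (hH : H.IsHadamard) (i j : Fin N) :
    ∑ l, H i l * H j l = if i = j then (N : ℝ) else 0 := by
  have := congrFun (congrFun hH.mul_conjTranspose i) j
  simpa [Matrix.mul_apply, Matrix.one_apply] using this

theorem hadamard_sum_sq (hH : H.IsHadamard) (a : Fin N → ℝ) :
    ∑ i, (∑ l, H i l * a l) ^ 2 = N * ∑ l, a l ^ 2 := by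
  have h1 : ∑ i, (∑ l, H i l * a l) ^ 2 = (H.mulVec a) ⬝ᵥ (H.mulVec a) := by
    simp [Matrix.mulVec, dotProduct, sq]
  have h2 : H.transpose * H = (N : ℝ) • (1 : Matrix (Fin N) (Fin N) ℝ) := by
    have := hH.conjTranspose_mul
    rwa [Matrix.conjTranspose_eq_transpose_of_trivial, Fintype.card_fin] at this
  rw [h1, Matrix.dotProduct_mulVec, ← Matrix.mulVec_transpose, Matrix.mulVec_mulVec, h2,
    Matrix.smul_mulVec, Matrix.one_mulVec, smul_dotProduct]
  simp [dotProduct, sq]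

end Hadamard

/-! ### The hard streams: spectral gap and forced correlation -/

section HardStreams

variable {d N : ℕ} (e : Fin N ⊕ Fin N ↪ Fin d)

/-- The vector with coordinates `f` at the places `e`, and zeros elsewhere. -/
def embed (f : Fin N ⊕ Fin N → ℝ) : Vec d := WithLp.toLp 2 (Function.extend e f 0)

theorem inner_embed (f : Fin N ⊕ Fin N → ℝ) (w : Vec d) :
    inner ℝ (embed e f) w = ∑ s, f s * w (e s) := by
  rw [PiLp.inner_apply]
  symm
  refine Fintype.sum_of_injective e e.injective _ _ (fun j hj => ?_) fun s => ?_
  · simp only [embed]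
    rw [Function.extend_apply' _ _ _ (by simpa using hj)]
    simp
  · simp only [embed]
    rw [e.injective.extend_apply]
    simp [mul_comm]

theorem embed_apply (f : Fin N ⊕ Fin N → ℝ) (s : Fin N ⊕ Fin N) : embed e f (e s) = f s :=
  e.injective.extend_apply _ _ _

theorem inner_embed_embed (f g : Fin N ⊕ Fin N → ℝ) :
    inner ℝ (embed e f) (embed e g) = ∑ s, f s * g s := by
  simp only [inner_embed, embed_apply]

theorem embed_mem_signs {f : Fin N ⊕ Fin N → ℝ} (hf : ∀ s, f s = -1 ∨ f s = 0 ∨ f s = 1)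
    (j : Fin d) : embed e f j = -1 ∨ embed e f j = 0 ∨ embed e f j = 1 := by
  by_cases hj : ∃ s, e s = j
  · obtain ⟨s, rfl⟩ := hj
    rw [embed_apply]
    exact hf s
  · right; left
    exact Function.extend_apply' _ _ _ hj

theorem sum_sq_comp_embedding_le (w : Vec d) :
    ∑ l, w (e (Sum.inl l)) ^ 2 + ∑ l, w (e (Sum.inr l)) ^ 2 ≤ ‖w‖ ^ 2 := by
  rw [EuclideanSpace.real_norm_sq_eq, ← Fintype.sum_sum_type (fun s => w (e s) ^ 2)]
  rw [← Finset.sum_map Finset.univ e (fun j => w j ^ 2)]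
  exact Finset.sum_le_sum_of_subset_of_nonneg (Finset.subset_univ _) fun _ _ _ => sq_nonneg _

variable (H : Matrix (Fin N) (Fin N) ℝ)

/-- A data row: a row of a Hadamard matrix, followed by a row of the sign matrix `Z`. -/
def dataRow (Z : Fin N → Fin N → Bool) (j : Fin N) : Vec d :=
  embed e (Sum.elim (H j) fun l => sgn (Z j l))

/-- The Hadamard part of the `i`-th data row. -/
def anchor (i : Fin N) : Vec d := embed e (Sum.elim (H i) 0)

/-- The sign part of a data row. -/
def hiddenPart (z : Fin N → Bool) : Vec d := embed e (Sum.elim 0 fun l => sgn (z l))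

/-- The first part of a hard stream, which depends on the sign matrix. -/
def dataStream (Z : Fin N → Fin N → Bool) : List (Vec d) := List.ofFn (dataRow e H Z)

/-- The second part of a hard stream, which raises the `i`-th data row above the others. -/
def queryStream (k : ℕ) (i : Fin N) : List (Vec d) :=
  List.replicate k (anchor e H i) ++ List.replicate (d - N - k) 0

theorem sum_map_hardStream (Z : Fin N → Fin N → Bool) (k : ℕ) (i : Fin N) (φ : Vec d → ℝ)
    (hφ : φ 0 = 0) :
    ((dataStream e H Z ++ queryStream e H k i).map φ).sum =
      ∑ j, φ (dataRow e H Z j) + k * φ (anchor e H i) := by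
  simp [dataStream, queryStream, List.sum_ofFn, hφ]

theorem length_hardStream (Z : Fin N → Fin N → Bool) {k : ℕ} (i : Fin N) (hk : N + k ≤ d) :
    (dataStream e H Z ++ queryStream e H k i).length = d := by
  simp [dataStream, queryStream]
  omega

variable {e H}

theorem inner_hiddenPart (z : Fin N → Bool) (w : Vec d) :
    inner ℝ w (hiddenPart e z) = ∑ l, w (e (Sum.inr l)) * sgn (z l) := by
  rw [real_inner_comm, hiddenPart, inner_embed, Fintype.sum_sum_type]
  simp [mul_comm]

theorem norm_sq_hiddenPart (z : Fin N → Bool) : ‖hiddenPart e z‖ ^ 2 = N := by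
  rw [← real_inner_self_eq_norm_sq, hiddenPart, inner_embed_embed, Fintype.sum_sum_type]
  simp [sgn_mul_self]

theorem inner_anchor_hiddenPart (i : Fin N) (z : Fin N → Bool) :
    inner ℝ (anchor e H i) (hiddenPart e z) = 0 := by
  rw [anchor, hiddenPart, inner_embed_embed, Fintype.sum_sum_type]
  simp

theorem inner_dataRow_hiddenPart (Z : Fin N → Fin N → Bool) (i : Fin N) :
    inner ℝ (dataRow e H Z i) (hiddenPart e (Z i)) = N := by
  rw [dataRow, hiddenPart, inner_embed_embed, Fintype.sum_sum_type]
  simp [sgn_mul_self]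

theorem norm_sq_anchor (hH : H.IsHadamard) (i : Fin N) : ‖anchor e H i‖ ^ 2 = N := by
  rw [← real_inner_self_eq_norm_sq, anchor, inner_embed_embed, Fintype.sum_sum_type]
  simp [hadamard_sum_mul hH]

theorem inner_dataRow_anchor (hH : H.IsHadamard) (Z : Fin N → Fin N → Bool) (i j : Fin N) :
    inner ℝ (dataRow e H Z j) (anchor e H i) = if j = i then (N : ℝ) else 0 := by
  rw [dataRow, anchor, inner_embed_embed, Fintype.sum_sum_type]
  simp [hadamard_sum_mul hH]

/-- The Hadamard block contributes `N` and the sign block `160 N`; `(a + b)² ≤ 2a² + 2b²` doubles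
the larger one to `320 N`. -/
theorem sum_inner_dataRow_sq_le (hH : H.IsHadamard) {Z : Fin N → Fin N → Bool}
    (hZ : BoundedSigns Z) (w : Vec d) :
    ∑ j, inner ℝ (dataRow e H Z j) w ^ 2 ≤ 320 * N * ‖w‖ ^ 2 := by
  have h1 := hadamard_sum_sq hH fun l => w (e (Sum.inl l))
  have h2 := hZ fun l => w (e (Sum.inr l))
  have h3 := sum_sq_comp_embedding_le e w
  rw [Fintype.card_fin] at h2
  have h4 : ∀ j, inner ℝ (dataRow e H Z j) w ^ 2 ≤
      2 * (∑ l, H j l * w (e (Sum.inl l))) ^ 2 +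
        2 * (∑ l, sgn (Z j l) * w (e (Sum.inr l))) ^ 2 := by
    intro j
    rw [dataRow, inner_embed, Fintype.sum_sum_type]
    simp only [Sum.elim_inl, Sum.elim_inr]
    nlinarith [sq_nonneg ((∑ l, H j l * w (e (Sum.inl l))) -
      ∑ l, sgn (Z j l) * w (e (Sum.inr l)))]
  refine (Finset.sum_le_sum fun j _ => h4 j).trans ?_
  rw [Finset.sum_add_distrib, ← Finset.mul_sum, ← Finset.mul_sum, h1]
  have hN : (0 : ℝ) ≤ N := Nat.cast_nonneg N
  have ha : 0 ≤ ∑ l, w (e (Sum.inl l)) ^ 2 := Finset.sum_nonneg fun _ _ => sq_nonneg _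
  have h5 := mul_le_mul_of_nonneg_left h3 hN
  have h6 := mul_nonneg hN ha
  linarith

/-- The Rayleigh quotient at the anchor: each of its `k` copies contributes `N²`, against a squared
norm `N`. -/
theorem le_eigenvalue_hardStream (hH : H.IsHadamard) (Z : Fin N → Fin N → Bool)
    {k : ℕ} (hkd : N + k ≤ d) (i : Fin N) :
    (k : ℝ) * N ≤ d * eigenvalue (dataStream e H Z ++ queryStream e H k i) 0 := by
  have h1 := sum_inner_sq_le_eigenvalue_zero (dataStream e H Z ++ queryStream e H k i)
    (anchor e H i)
  rw [sum_map_hardStream _ _ _ _ _ _ (by simp), length_hardStream _ _ _ _ hkd,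
    norm_sq_anchor hH, real_inner_self_eq_norm_sq, norm_sq_anchor hH] at h1
  have hN : (0 : ℝ) < N := by exact_mod_cast i.pos
  have h2 : 0 ≤ ∑ j, inner ℝ (dataRow e H Z j) (anchor e H i) *
      inner ℝ (dataRow e H Z j) (anchor e H i) :=
    Finset.sum_nonneg fun j _ => mul_self_nonneg _
  refine le_of_mul_le_mul_right ?_ hN
  linarith

/-- Orthogonally to the anchor only the data rows have energy, so `d λ₂ ≤ 320 N`, while `d λ₁ ≥ k
N`. -/
theorem hardStream_mem_gapStreams (hH : H.IsHadamard) {Z : Fin N → Fin N → Bool}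
    (hZ : BoundedSigns Z) {k : ℕ} (hkd : N + k ≤ d) {R : ℝ} (hR : 0 < R) (hkR : R * 320 ≤ k)
    (i : Fin N) :
    dataStream e H Z ++ queryStream e H k i ∈ gapStreams d R := by
  have hN : (0 : ℝ) < N := by exact_mod_cast i.pos
  have hk0 : (0 : ℝ) < k := by linarith
  have hk0' : 0 < k := by exact_mod_cast hk0
  have hipos := i.pos
  have hd : 2 ≤ d := by omega
  have hd0 : (0 : ℝ) < d := by exact_mod_cast (by omega : 0 < d)
  have hlow := le_eigenvalue_hardStream (e := e) hH Z hkd i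
  refine ⟨length_hardStream _ _ _ _ hkd, ?_, ?_, ?_⟩
  · intro x hx j
    have hsgn : ∀ b, sgn b = -1 ∨ sgn b = 0 ∨ sgn b = 1 := by intro b; cases b <;> simp [sgn]
    have hHe : ∀ i j, H i j = -1 ∨ H i j = 0 ∨ H i j = 1 := fun i j =>
      (hadamard_apply hH i j).imp_right Or.inr
    simp only [dataStream, queryStream, List.mem_append, List.mem_ofFn,
      List.mem_replicate] at hx
    rcases hx with ⟨i', rfl⟩ | ⟨-, rfl⟩ | ⟨-, rfl⟩
    · refine embed_mem_signs e (fun s => ?_) j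
      rcases s with s | s
      · exact hHe _ _
      · exact hsgn _
    · refine embed_mem_signs e (fun s => ?_) j
      rcases s with s | s
      · exact hHe _ _
      · simp
    · simp
  · exact (mul_pos_iff_of_pos_left hd0).1 (lt_of_lt_of_le (by positivity) hlow)
  · have h1 := eigenvalue_one_le hd (dataStream e H Z ++ queryStream e H k i) (anchor e H i)
      (K := 320 * N) (by
        intro w hw
        rw [sum_map_hardStream _ _ _ _ _ _ (by simp), hw]
        simpa [sq] using sum_inner_dataRow_sq_le (e := e) hH hZ w)
    rw [length_hardStream _ _ _ _ hkd] at h1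
    refine le_of_mul_le_mul_left ?_ hd0
    have h2 := mul_le_mul_of_nonneg_left h1 hR.le
    have h3 := mul_le_mul_of_nonneg_right hkR hN.le
    linarith

/-- An approximate solution on a hard stream is correlated with the hidden signs. -/
theorem IsApproxPCA.correlated (hH : H.IsHadamard) {Z : Fin N → Fin N → Bool}
    (hZ : BoundedSigns Z) {k : ℕ} (hkd : N + k ≤ d) (hk : (16 : ℝ) * 320 ^ 3 ≤ k)
    (i : Fin N) {u : Vec d}
    (hu : IsApproxPCA ((1 / (8 * (320 + k : ℝ))) ^ 2)
      (dataStream e H Z ++ queryStream e H k i) u) :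
    1 / (8 * (320 + k : ℝ)) * √N ≤ |∑ l, u (e (Sum.inr l)) * sgn (Z i l)| := by
  obtain ⟨hu1, v, hv, huv⟩ := hu
  have hN : (0 : ℝ) < N := by exact_mod_cast i.pos
  rw [← inner_hiddenPart]
  refine le_abs_inner_of_approx (by linarith) (norm_sq_hiddenPart _) hv.1 hu1 ?_ huv
  refine le_abs_inner_of_eigenvector (x := dataRow e H Z) (i := i) (y := anchor e H i) hN
    (by norm_num) hk (sum_inner_dataRow_sq_le hH hZ) (inner_dataRow_anchor hH Z i)
    (norm_sq_anchor hH i) (norm_sq_hiddenPart _) (inner_anchor_hiddenPart i _)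
    (inner_dataRow_hiddenPart Z i) hv.1 (fun w => ?_) (le_eigenvalue_hardStream (e := e) hH Z hkd i)
  rw [← sum_map_hardStream e H Z k i (fun x => inner ℝ x v * inner ℝ x w) (by simp),
    hv.sum_inner, length_hardStream _ _ _ _ hkd]

end HardStreams

/-! ### Composition and measurability of runs -/

namespace StreamingAlgorithm

variable {d : ℕ} {Ω : Type*} [MeasurableSpace Ω] (alg : StreamingAlgorithm d Ω)

theorem runFrom_append (ω : Ω) (t : ℕ) (s : List Bool) (xs ys : List (Vec d)) :
    alg.runFrom ω t s (xs ++ ys) =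
      alg.runFrom ω (t + xs.length) (alg.runFrom ω t s xs) ys := by
  induction xs generalizing t s with
  | nil => rfl
  | cons x xs ih =>
    rw [List.cons_append, runFrom, ih, runFrom, List.length_cons]
    congr 1
    omega

theorem memory_append (ω : Ω) (xs ys : List (Vec d)) :
    alg.memory ω (xs ++ ys) = alg.runFrom ω xs.length (alg.memory ω xs) ys := by
  rw [memory, runFrom_append, Nat.zero_add, ← memory]

/-- There are countably many bit strings, so each step splits into a countable union over the
previous state. The random initial state `m` lets the induction absorb that step. -/
theorem measurableSet_runFrom (xs : List (Vec d)) (t : ℕ) (m : Ω → List Bool)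
    (hm : ∀ s, MeasurableSet {ω | m ω = s}) (s : List Bool) :
    MeasurableSet {ω | alg.runFrom ω t (m ω) xs = s} := by
  induction xs generalizing t m with
  | nil => exact hm s
  | cons x xs ih =>
    refine ih (t + 1) (fun ω => alg.step ω t (m ω) x) fun s' => ?_
    have : {ω | alg.step ω t (m ω) x = s'} =
        ⋃ r, {ω | m ω = r} ∩ {ω | alg.step ω t r x = s'} := by
      ext ω
      simp
    rw [this]
    exact MeasurableSet.iUnion fun r => (hm r).inter (alg.measurable_step t r x s')

theorem measurableSet_memory (xs : List (Vec d)) (s : List Bool) :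
    MeasurableSet {ω | alg.memory ω xs = s} :=
  alg.measurableSet_runFrom xs 0 _ alg.measurable_init s

theorem measurable_length_memory (xs : List (Vec d)) :
    Measurable fun ω => (alg.memory ω xs).length := by
  refine measurable_to_countable' fun n => ?_
  have : (fun ω => (alg.memory ω xs).length) ⁻¹' {n} =
      ⋃ s : {s : List Bool // s.length = n}, {ω | alg.memory ω xs = s} := by
    ext ω
    simp
  rw [this]
  exact MeasurableSet.iUnion fun s => alg.measurableSet_memory xs s

theorem measurable_result (xs : List (Vec d)) : Measurable fun ω => alg.result ω xs := by
  intro B hB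
  have : (fun ω => alg.result ω xs) ⁻¹' B =
      ⋃ s, {ω | alg.memory ω xs = s} ∩ (fun ω => alg.output ω s) ⁻¹' B := by
    ext ω
    simp [result]
  rw [this]
  exact MeasurableSet.iUnion fun s =>
    (alg.measurableSet_memory xs s).inter (alg.measurable_output s hB)

end StreamingAlgorithm

/-! ### Fixing the seed and counting messages -/

section Counting

open MeasureTheory

/-- If every event of a finite family has probability at least `2/3`, and the side conditions
hold with probability at least `5/6`, then some outcome is good for a quarter of the family. -/
theorem exists_outcome_many {Ω α ι : Type*} [MeasurableSpace Ω] (P : Measure Ω)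
    [IsProbabilityMeasure P] [Fintype ι] (G : Finset α) (A : α → ι → Set Ω) (F : α → Set Ω)
    (hAm : ∀ a i, MeasurableSet (A a i)) (hFm : ∀ a, MeasurableSet (F a))
    (hA : ∀ a ∈ G, ∀ i, 2 / 3 ≤ P.real (A a i)) (hF : ∀ a ∈ G, P.real (F a)ᶜ ≤ 1 / 6)
    [Nonempty ι] :
    ∃ ω, ∃ G' ⊆ G, (G.card : ℝ) / 4 ≤ G'.card ∧ ∀ a ∈ G', ω ∈ F a ∧
      ∃ I : Finset ι, Fintype.card ι ≤ 4 * I.card ∧ ∀ i ∈ I, ω ∈ A a i := by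
  classical
  have hint : ∀ a i, Integrable ((A a i ∩ F a).indicator (1 : Ω → ℝ)) P := fun a i =>
    (integrable_const (1 : ℝ)).indicator ((hAm a i).inter (hFm a))
  obtain ⟨ω, hω⟩ := exists_integral_le (μ := P)
    (f := fun ω => ∑ a ∈ G, ∑ i, (A a i ∩ F a).indicator (1 : Ω → ℝ) ω)
    (integrable_finsetSum _ fun a _ => integrable_finsetSum _ fun i _ => hint a i)
  have hlow : (G.card : ℝ) * Fintype.card ι / 2 ≤
      ∫ ω, ∑ a ∈ G, ∑ i, (A a i ∩ F a).indicator (1 : Ω → ℝ) ω ∂P := by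
    rw [integral_finsetSum _ fun a _ => integrable_finsetSum _ fun i _ => hint a i]
    have hone : ∀ a ∈ G, (Fintype.card ι : ℝ) / 2 ≤
        ∫ ω, ∑ i, (A a i ∩ F a).indicator (1 : Ω → ℝ) ω ∂P := by
      intro a ha
      rw [integral_finsetSum _ fun i _ => hint a i]
      -- `2/3 - 1/6 = 1/2`, so some seed is good for half of all pairs `(a, i)`.
      have : ∀ i ∈ Finset.univ, (1 / 2 : ℝ) ≤
          ∫ ω, (A a i ∩ F a).indicator (1 : Ω → ℝ) ω ∂P := by
        intro i _
        rw [integral_indicator_one ((hAm a i).inter (hFm a))]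
        have h1 : P.real (A a i) ≤ P.real (A a i ∩ F a) + P.real (F a)ᶜ := by
          refine (measureReal_mono ?_).trans (measureReal_union_le _ _)
          intro x hx
          by_cases hxF : x ∈ F a
          · exact Or.inl ⟨hx, hxF⟩
          · exact Or.inr hxF
        linarith [hA a ha i, hF a ha]
      have h2 := Finset.card_nsmul_le_sum _ _ _ this
      rw [nsmul_eq_mul, Finset.card_univ] at h2
      linarith
    have h2 := Finset.card_nsmul_le_sum _ _ _ hone
    rw [nsmul_eq_mul] at h2
    linarith
  set T : α → Finset ι := fun a => Finset.univ.filter fun i => ω ∈ A a i ∩ F a with hT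
  have hsum : ∀ a, ∑ i, (A a i ∩ F a).indicator (1 : Ω → ℝ) ω = (T a).card := by
    intro a
    simp only [Set.indicator_apply, Pi.one_apply, hT]
    rw [Finset.sum_boole]
  simp only [hsum] at hω
  have hι : (0 : ℝ) < Fintype.card ι := by exact_mod_cast Fintype.card_pos
  set G' := G.filter fun a => Fintype.card ι ≤ 4 * (T a).card with hG'
  refine ⟨ω, G', Finset.filter_subset _ _, ?_, ?_⟩
  -- Members outside `G'` account for less than a quarter of the pairs, so `G'` must supply the
  -- other quarter.
  · have hupper : ∑ a ∈ G, ((T a).card : ℝ) ≤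
        ∑ a ∈ G, ((if Fintype.card ι ≤ 4 * (T a).card then (Fintype.card ι : ℝ) else 0) +
          Fintype.card ι / 4) := by
      refine Finset.sum_le_sum fun a _ => ?_
      split_ifs with h
      · have : ((T a).card : ℝ) ≤ Fintype.card ι := by exact_mod_cast Finset.card_le_univ _
        linarith
      · have : (4 : ℝ) * (T a).card < Fintype.card ι := by exact_mod_cast not_le.1 h
        linarith
    rw [Finset.sum_add_distrib, ← Finset.sum_filter, Finset.sum_const, Finset.sum_const,
      nsmul_eq_mul, nsmul_eq_mul, ← hG'] at hupper
    refine le_of_mul_le_mul_right ?_ hι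
    linarith [hlow.trans (hω.trans hupper)]
  · intro a ha
    have ha' := (Finset.mem_filter.1 ha).2
    have hmem : ∀ i ∈ T a, ω ∈ A a i ∩ F a := fun i hi => (Finset.mem_filter.1 hi).2
    have hne : (T a).Nonempty := by
      rw [← Finset.card_pos]
      have : 0 < Fintype.card ι := Fintype.card_pos
      omega
    obtain ⟨i, hi⟩ := hne
    exact ⟨(hmem i hi).2, T a, ha', fun j hj => (hmem j hj).1⟩

/-- There are fewer than `2 ^ (L + 1)` messages of at most `L` bits. -/
theorem card_le_of_short_messages {α : Type*} (G : Finset α) (m : α → List Bool) (L : ℕ)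
    (hL : ∀ a ∈ G, (m a).length ≤ L) (B : ℝ) (hB0 : 0 ≤ B)
    (hB : ∀ s, ((G.filter fun a => m a = s).card : ℝ) ≤ B) :
    (G.card : ℝ) ≤ 2 ^ (L + 1) * B := by
  classical
  set M : Finset (List Bool) := (Finset.range (L + 1)).biUnion fun l =>
    (Finset.univ : Finset (Fin l → Bool)).image List.ofFn with hM
  have hMcard : M.card ≤ 2 ^ (L + 1) := by
    refine Finset.card_biUnion_le.trans ?_
    calc ∑ l ∈ Finset.range (L + 1), ((Finset.univ : Finset (Fin l → Bool)).image List.ofFn).card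
        ≤ ∑ l ∈ Finset.range (L + 1), 2 ^ l := by
          refine Finset.sum_le_sum fun l _ => Finset.card_image_le.trans ?_
          simp
      _ ≤ 2 ^ (L + 1) := by
          rw [Nat.geomSum_eq le_rfl]
          simp
  have hmaps : ∀ a ∈ G, m a ∈ M := by
    intro a ha
    refine Finset.mem_biUnion.2 ⟨(m a).length, ?_, ?_⟩
    · exact Finset.mem_range.2 (Nat.lt_succ_of_le (hL a ha))
    · exact Finset.mem_image.2 ⟨(m a).get, Finset.mem_univ _, List.ofFn_get _⟩
  rw [Finset.card_eq_sum_card_fiberwise hmaps]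
  push_cast
  calc ∑ s ∈ M, ((G.filter fun a => m a = s).card : ℝ) ≤ ∑ _s ∈ M, B :=
        Finset.sum_le_sum fun s _ => hB s
    _ = M.card * B := by rw [Finset.sum_const, nsmul_eq_mul]
    _ ≤ 2 ^ (L + 1) * B := by
        gcongr
        exact_mod_cast hMcard

end Counting

/-! ### Compression of sign matrices -/

section LowerBound

open MeasureTheory

variable {d N : ℕ} {Ω : Type*} [MeasurableSpace Ω]

/-- If an algorithm solves approximate PCA on the hard streams and stores fewer than `b` bits in
expectation after the data part, then all bounded sign matrices can be compressed, which bounds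
`b` from below. -/
theorem exists_compression {k : ℕ} {e : Fin N ⊕ Fin N ↪ Fin d} {H : Matrix (Fin N) (Fin N) ℝ}
    (hH : H.IsHadamard) (hN : 0 < N) (hkd : N + k ≤ d) {R : ℝ} (hR : 0 < R)
    (hkR : R * 320 ≤ k) (hk : (16 : ℝ) * 320 ^ 3 ≤ k) (P : Measure Ω) [IsProbabilityMeasure P]
    (alg : StreamingAlgorithm d Ω)
    (hsolves : alg.SolvesPCA P ((1 / (8 * (320 + k : ℝ))) ^ 2) (gapStreams d R))
    {b : ℝ} (hb : 0 ≤ b)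
    (hbits : ∀ Z : Fin N → Fin N → Bool, BoundedSigns Z →
      alg.expectedBits P (dataStream e H Z) ≤ ENNReal.ofReal b) :
    Real.exp ((1 / (8 * (320 + k : ℝ))) ^ 2 * (N : ℝ) ^ 2 / 32) ≤ 2 ^ (⌊6 * b⌋₊ + N + 4) := by
  classical
  have : Nonempty (Fin N) := ⟨⟨0, hN⟩⟩
  set δ : ℝ := 1 / (8 * (320 + k : ℝ)) with hδ
  have hδ0 : 0 < δ := by positivity
  have hsN : 0 < √(N : ℝ) := Real.sqrt_pos.2 (by exact_mod_cast hN)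
  -- By Markov, more than `L` bits are stored with probability at most `b / (L + 1) ≤ 1/6`.
  set L := ⌊6 * b⌋₊ with hL
  set G := Finset.univ.filter fun Z : Fin N → Fin N → Bool => BoundedSigns Z with hG
  set res : (Fin N → Fin N → Bool) → Fin N → Ω → Vec d := fun Z i ω =>
    alg.result ω (dataStream e H Z ++ queryStream e H k i) with hres
  -- A visibly measurable event containing the success event, which spares a proof that the latter
  -- is measurable.
  set A : (Fin N → Fin N → Bool) → Fin N → Set Ω := fun Z i =>
    {ω | ‖res Z i ω‖ = 1 ∧ δ * √N ≤ |∑ l, res Z i ω (e (Sum.inr l)) * sgn (Z i l)|} with hA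
  set F : (Fin N → Fin N → Bool) → Set Ω := fun Z =>
    {ω | (alg.memory ω (dataStream e H Z)).length ≤ L} with hF
  have hAm : ∀ Z i, MeasurableSet (A Z i) := by
    intro Z i
    have hm : Measurable (res Z i) := alg.measurable_result _
    have hcorr : Measurable fun ω => |∑ l, res Z i ω (e (Sum.inr l)) * sgn (Z i l)| := by
      refine Measurable.abs (Finset.measurable_fun_sum _ fun l _ => ?_)
      have hcoord : Measurable fun w : Vec d => w (e (Sum.inr l)) := by fun_prop
      exact (hcoord.comp hm).mul_const _
    have hone : MeasurableSet {ω | ‖res Z i ω‖ = 1} :=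
      measurableSet_eq_fun hm.norm measurable_const
    have hlarge : MeasurableSet
        {ω | δ * √N ≤ |∑ l, res Z i ω (e (Sum.inr l)) * sgn (Z i l)|} :=
      measurableSet_le measurable_const hcorr
    exact hone.inter hlarge
  have hFm : ∀ Z, MeasurableSet (F Z) := fun Z =>
    measurableSet_le (alg.measurable_length_memory _) measurable_const
  have hAP : ∀ Z ∈ G, ∀ i, 2 / 3 ≤ P.real (A Z i) := by
    intro Z hZ i
    have hZ' : BoundedSigns Z := (Finset.mem_filter.1 hZ).2
    have h1 := (hsolves _ (hardStream_mem_gapStreams (e := e) hH hZ' hkd hR hkR i)).trans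
      (measure_mono (t := A Z i) fun ω hω => ⟨hω.1, hω.correlated hH hZ' hkd hk i⟩)
    have h2 := ENNReal.toReal_mono (measure_ne_top P _) h1
    simpa [Measure.real] using h2
  have hFP : ∀ Z ∈ G, P.real (F Z)ᶜ ≤ 1 / 6 := by
    intro Z hZ
    have hZ' : BoundedSigns Z := (Finset.mem_filter.1 hZ).2
    have hmeas : Measurable fun ω => ((alg.memory ω (dataStream e H Z)).length : ℝ≥0∞) :=
      (measurable_from_top (f := fun n : ℕ => (n : ℝ≥0∞))).comp (alg.measurable_length_memory _)
    have h1 := (mul_meas_ge_le_lintegral hmeas ((L + 1 : ℕ) : ℝ≥0∞)).trans (hbits Z hZ')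
    have h2 : {ω | ((L + 1 : ℕ) : ℝ≥0∞) ≤ ((alg.memory ω (dataStream e H Z)).length : ℝ≥0∞)} =
        (F Z)ᶜ := by
      ext ω
      simp only [hF, Set.mem_ofPred_eq, Set.mem_compl_iff, Nat.cast_le]
      omega
    rw [h2] at h1
    have h3 := ENNReal.toReal_mono ENNReal.ofReal_ne_top h1
    rw [ENNReal.toReal_mul, ENNReal.toReal_ofReal hb, ENNReal.toReal_natCast] at h3
    change ((L + 1 : ℕ) : ℝ) * P.real (F Z)ᶜ ≤ b at h3
    have h4 : 6 * b < (L + 1 : ℕ) := by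
      push_cast
      exact Nat.lt_floor_add_one _
    have h5 : 0 ≤ P.real (F Z)ᶜ := measureReal_nonneg
    have h6 : (0 : ℝ) < (L + 1 : ℕ) := by positivity
    refine le_of_mul_le_mul_left ?_ h6
    linarith
  obtain ⟨ω, G', hG'G, hG'card, hG'⟩ := exists_outcome_many P G A F hAm hFm hAP hFP
  -- With `ω` fixed, the answers to all queries depend on `Z` only through the state `s` after the
  -- data part.
  set decoded : List Bool → Fin N → Vec d := fun s i =>
    alg.output ω (alg.runFrom ω N s (queryStream e H k i)) with hdec
  have hresdec : ∀ Z i, res Z i ω = decoded (alg.memory ω (dataStream e H Z)) i := by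
    intro Z i
    have hlen : (dataStream e H Z).length = N := by simp [dataStream]
    simp only [hres, hdec, StreamingAlgorithm.result, StreamingAlgorithm.memory_append, hlen]
  set B : ℝ := 2 ^ (N ^ 2 + N) * Real.exp (-(δ ^ 2 * (N : ℝ) ^ 2 / 32)) with hB
  have hfiber : ∀ s, ((G'.filter fun Z => alg.memory ω (dataStream e H Z) = s).card : ℝ) ≤ B := by
    intro s
    -- The default `0` keeps the norm bound for states whose output is not a unit vector; such rows
    -- are never among the good ones.
    set w : Fin N → Fin N → ℝ := fun i l =>
      if ‖decoded s i‖ = 1 then decoded s i (e (Sum.inr l)) else 0 with hw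
    have hw1 : ∀ i, ∑ l, w i l ^ 2 ≤ 1 := by
      intro i
      by_cases h : ‖decoded s i‖ = 1
      · simp only [hw, if_pos h]
        have h1 := sum_sq_comp_embedding_le e (decoded s i)
        rw [h, one_pow] at h1
        have h2 : 0 ≤ ∑ l, decoded s i (e (Sum.inl l)) ^ 2 :=
          Finset.sum_nonneg fun _ _ => sq_nonneg _
        linarith
      · simp [hw, h]
    have h1 := card_sign_matrices_correlated_le w hw1 hδ0.le
    rw [Fintype.card_fin] at h1
    refine le_trans ?_ h1
    refine Nat.cast_le.2 (Finset.card_le_card fun Z hZ => ?_)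
    obtain ⟨hZG, hZs⟩ := Finset.mem_filter.1 hZ
    obtain ⟨-, I, hI, hIA⟩ := hG' Z hZG
    rw [Fintype.card_fin] at hI
    refine Finset.mem_filter.2 ⟨Finset.mem_univ _, hI.trans ?_⟩
    refine Nat.mul_le_mul_left 4 (Finset.card_le_card fun i hi => ?_)
    have h2 := hIA i hi
    simp only [hA, Set.mem_ofPred_eq, hresdec, hZs] at h2
    refine Finset.mem_filter.2 ⟨Finset.mem_univ _, ?_⟩
    simp only [hw, if_pos h2.1]
    exact h2.2
  have hupper := card_le_of_short_messages G' (fun Z => alg.memory ω (dataStream e H Z)) L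
    (fun Z hZ => (hG' Z hZ).1) B (by positivity) hfiber
  have hlower := card_boundedSigns (ι := Fin N)
  rw [Fintype.card_fin] at hlower
  -- Half of all sign matrices are bounded, and the seed is good for a quarter of these.
  have h1 : (2 : ℝ) ^ (N ^ 2) / 8 ≤ 2 ^ (L + 1) * B := by
    have : (2 : ℝ) ^ (N ^ 2) / 2 ≤ G.card := by
      convert hlower
    linarith
  rw [hB, Real.exp_neg] at h1
  have hexp := Real.exp_pos (δ ^ 2 * (N : ℝ) ^ 2 / 32)
  have h2N : (0 : ℝ) < 2 ^ (N ^ 2) := by positivity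
  have h2 : (2 : ℝ) ^ (L + 1) * (2 ^ (N ^ 2 + N) * (Real.exp (δ ^ 2 * (N : ℝ) ^ 2 / 32))⁻¹) =
      2 ^ (N ^ 2) / 8 * (2 ^ (L + N + 4) / Real.exp (δ ^ 2 * (N : ℝ) ^ 2 / 32)) := by
    rw [pow_add, pow_add, pow_add, pow_add]
    field_simp
    ring
  rw [h2] at h1
  have h3 : 1 ≤ 2 ^ (L + N + 4) / Real.exp (δ ^ 2 * (N : ℝ) ^ 2 / 32) := by
    refine le_of_mul_le_mul_left ?_ (by positivity : (0 : ℝ) < 2 ^ (N ^ 2) / 8)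
    rwa [mul_one]
  rwa [le_div_iff₀ hexp, one_mul] at h3

end LowerBound

end StreamingPCA

end

/-! ### Choice of constants and conclusion -/

theorem theorem5 (R : ℝ) (hR : 1 < R) :
    ∃ ε : ℝ, 0 < ε ∧ ∃ c : ℝ, 0 < c ∧ ∃ d₀ : ℕ, ∀ d : ℕ, d₀ ≤ d →
      ∀ (Ω : Type*) [MeasurableSpace Ω] (P : MeasureTheory.Measure Ω)
        [MeasureTheory.IsProbabilityMeasure P]
        (alg : StreamingPCA.StreamingAlgorithm d Ω),
        alg.SolvesPCA P ε (StreamingPCA.gapStreams d R) →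
          ∃ xs ∈ StreamingPCA.gapStreams d R, ∃ t ≤ d,
            ENNReal.ofReal (c * (d : ℝ) ^ 2) ≤ alg.expectedBits P (xs.take t) := by
  obtain ⟨k, hk⟩ := exists_nat_ge (R * 320 + 16 * 320 ^ 3)
  have hkR : R * 320 ≤ k := by linarith
  have hk' : (16 : ℝ) * 320 ^ 3 ≤ k := by linarith
  set δ : ℝ := 1 / (8 * (320 + k : ℝ)) with hδ
  have hδ0 : 0 < δ := by positivity
  obtain ⟨m, hm⟩ := exists_nat_gt (320 / δ ^ 2)
  -- `6144 = 6 · 16 · 64`: 6 from Markov and 16 from `d ≤ 4N`, so that `L ≤ δ² N² / 64`. With `320 =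
  -- 5 · 64`, `N ≥ m` makes `N + 4 ≤ 5N` less than another `δ² N² / 64`; together they stay below
  -- the exponent `δ² N² / 32`.
  refine ⟨δ ^ 2, by positivity, δ ^ 2 / 6144, by positivity, 4 * (k + m + 1),
    fun d hd Ω _ P _ alg hsolves => ?_⟩
  have hd2 : d / 2 ≠ 0 := by omega
  set N := 2 ^ Nat.log 2 (d / 2) with hN
  have hN2 : N ≤ d / 2 := Nat.pow_log_le_self 2 hd2
  have hN4 : d / 2 < 2 * N := by
    have := Nat.lt_pow_succ_log_self (b := 2) (by norm_num) (d / 2)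
    rwa [pow_succ, mul_comm] at this
  have hNpos : 0 < N := by positivity
  have hkd : N + k ≤ d := by omega
  have hmN : m ≤ N := by omega
  have hdN : d ≤ 4 * N := by omega
  obtain ⟨H, hH⟩ := StreamingPCA.exists_isHadamard_two_pow (Nat.log 2 (d / 2))
  obtain ⟨e⟩ : Nonempty (Fin N ⊕ Fin N ↪ Fin d) := by
    refine Function.Embedding.nonempty_of_card_le ?_
    simp only [Fintype.card_sum, Fintype.card_fin]
    omega
  by_contra! hcon
  have hcomp := StreamingPCA.exists_compression (e := e) hH hNpos hkd (by linarith) hkR hk' P alg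
    -- All queries share the same data prefix, so query `0` at time `N` already bounds the bits
    -- stored after it.
    hsolves (b := δ ^ 2 / 6144 * (d : ℝ) ^ 2) (by positivity) (fun Z hZ => by
      have h := hcon _ (StreamingPCA.hardStream_mem_gapStreams (e := e) hH hZ hkd (by linarith)
        hkR ⟨0, hNpos⟩) N (by omega)
      have hlen : (StreamingPCA.dataStream e H Z).length = N := by
        simp [StreamingPCA.dataStream, hN]
      rw [List.take_left' hlen] at h
      exact h.le)
  set L := ⌊6 * (δ ^ 2 / 6144 * (d : ℝ) ^ 2)⌋₊ with hL
  have hNr : (1 : ℝ) ≤ N := by exact_mod_cast hNpos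
  have hLle : (L : ℝ) ≤ δ ^ 2 * (N : ℝ) ^ 2 / 64 := by
    have h1 : (L : ℝ) ≤ 6 * (δ ^ 2 / 6144 * (d : ℝ) ^ 2) := Nat.floor_le (by positivity)
    have h2 : (d : ℝ) ≤ 4 * N := by exact_mod_cast hdN
    have h3 : (d : ℝ) ^ 2 ≤ (4 * N) ^ 2 := by gcongr
    have h4 : δ ^ 2 / 6144 * (d : ℝ) ^ 2 ≤ δ ^ 2 / 6144 * (4 * N) ^ 2 := by gcongr
    linarith
  have hNlarge : 5 * (N : ℝ) < δ ^ 2 * (N : ℝ) ^ 2 / 64 := by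
    have h1 : 320 / δ ^ 2 < N := hm.trans_le (by exact_mod_cast hmN)
    rw [div_lt_iff₀ (by positivity)] at h1
    have h2 : 320 * (N : ℝ) < N * δ ^ 2 * N := by gcongr
    linarith
  have h2e : (2 : ℝ) ^ (L + N + 4) ≤ Real.exp (L + N + 4) := by
    have h1 : (2 : ℝ) ≤ Real.exp 1 := by linarith [Real.exp_one_gt_d9]
    calc (2 : ℝ) ^ (L + N + 4) ≤ Real.exp 1 ^ (L + N + 4) := by gcongr
      _ = Real.exp (L + N + 4) := by rw [← Real.exp_nat_mul]; push_cast; ring_nf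
  have h3 := Real.exp_le_exp.1 (hcomp.trans h2e)
  linarith
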